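/- Let $h$ be an indeterminate and let $\mathcal U=\mathcal U_h(\mathfrak{sl}_2)$ be the $h$-adically complete $\mathbb C[[h]]$-algebra topologically generated by $H,x,y$ subject to $$Hx-xH=2x,\qquad Hy-yH=-2y,\qquad xy-yx=\frac{e^{hH/2}-e^{-hH/2}}{e^{h/2}-e^{-h/2}}.$$ Put $q=e^{h/2}$ and $k=e^{hH/4}$, and for $n\ge 0$ put $[n]=\frac{q^n-q^{-n}}{q-q^{-1}}$ and $[n]!=[1][2]\cdots[n]$. Let $S:\mathcal U\to\mathcal U$ be the antipode of $\mathcal U$, that is, the $\mathbb C[[h]]$-linear algebra anti-homomorphism with $$S(H)=-H,\qquad S(x)=-q\,x,\qquad S(y)=-q^{-1}y.$$ Let $$R=e^{\frac h4 H\otimes H}\sum_{n\ge 0}\frac{(q-q^{-1})^n}{[n]!}\,q^{\frac12 n(n-3)}\,(kx)^n\otimes(k^{-1}y)^n$$ in the $h$-adically completed tensor product $\mathcal U\,\widehat\otimes_{\mathbb C[[h]]}\,\mathcal U$. Let $u=\sum_i S(\beta_i)\,\alpha_i\in\mathcal U$, where $R=\sum_i\alpha_i\otimes\beta_i$, be the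 Drinfeld element of $R$; that is, $u$ is the image of $R$ under the continuous extension of the linear map $a\otimes b\mapsto S(b)\,a$ to the completed tensor product. Then $$S(u)=k^{-4}\,u .$$ -/

import Mathlib

open PowerSeries
open scoped TensorProduct

noncomputable section

namespace Uhsl2

/-! The `h`-adic completion of an associative `ℂ⟦h⟧`-algebra; the indeterminate `h` is
`PowerSeries.X`. -/

section Completion

/-- The two-sided ideal `hⁿ B` of a `ℂ⟦h⟧`-algebra `B`. -/
def hIdeal (B : Type*) [Ring B] [Algebra ℂ⟦X⟧ B] (n : ℕ) : Ideal B where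
  carrier := {b | ∃ c : B, b = (X : ℂ⟦X⟧) ^ n • c}
  add_mem' := by
    rintro _ _ ⟨c, rfl⟩ ⟨d, rfl⟩
    exact ⟨c + d, (smul_add _ _ _).symm⟩
  zero_mem' := ⟨0, (smul_zero _).symm⟩
  smul_mem' := by
    rintro a _ ⟨c, rfl⟩
    exact ⟨a * c, by rw [smul_eq_mul, mul_smul_comm]⟩

variable {A B : Type*} [Ring A] [Algebra ℂ⟦X⟧ A] [Ring B] [Algebra ℂ⟦X⟧ B]

instance (n : ℕ) : (hIdeal B n).IsTwoSided where
  mul_mem_of_left := by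
    rintro _ b ⟨c, rfl⟩
    exact ⟨c * b, by rw [smul_mul_assoc]⟩

theorem mem_hIdeal {n : ℕ} {b : B} : b ∈ hIdeal B n ↔ ∃ c : B, b = (X : ℂ⟦X⟧) ^ n • c :=
  Iff.rfl

theorem hIdeal_le {m n : ℕ} (hmn : m ≤ n) : hIdeal B n ≤ hIdeal B m := by
  rintro _ ⟨c, rfl⟩
  exact ⟨(X : ℂ⟦X⟧) ^ (n - m) • c, by rw [smul_smul, ← pow_add, Nat.add_sub_cancel' hmn]⟩

/-- The inverse limit of the algebras `B / hⁿ B`, inside their product. -/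
def hLimit (B : Type*) [Ring B] [Algebra ℂ⟦X⟧ B] :
    Subalgebra ℂ⟦X⟧ (∀ n : ℕ, B ⧸ hIdeal B n) where
  carrier := {z | ∀ (m n : ℕ) (hmn : m ≤ n),
    Ideal.Quotient.factorₐ ℂ⟦X⟧ (hIdeal_le hmn) (z n) = z m}
  mul_mem' := by
    intro a b ha hb m n hmn
    rw [Pi.mul_apply, Pi.mul_apply, map_mul, ha m n hmn, hb m n hmn]
  add_mem' := by
    intro a b ha hb m n hmn
    rw [Pi.add_apply, Pi.add_apply, map_add, ha m n hmn, hb m n hmn]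
  algebraMap_mem' := by
    intro r m n hmn
    rw [Pi.algebraMap_apply, Pi.algebraMap_apply, AlgHom.commutes]

/-- The `h`-adic completion `lim B / hⁿ B` of a `ℂ⟦h⟧`-algebra `B`. -/
def HCompletion (B : Type*) [Ring B] [Algebra ℂ⟦X⟧ B] : Type _ := hLimit B

instance : Ring (HCompletion B) := inferInstanceAs (Ring (hLimit B))

instance : Algebra ℂ⟦X⟧ (HCompletion B) := inferInstanceAs (Algebra ℂ⟦X⟧ (hLimit B))

namespace HCompletion

/-- The projection to `B / hⁿ B`. -/
def eval (n : ℕ) : HCompletion B →ₐ[ℂ⟦X⟧] B ⧸ hIdeal B n :=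
  (Pi.evalAlgHom ℂ⟦X⟧ (fun n : ℕ => B ⧸ hIdeal B n) n).comp (hLimit B).val

/-- The element of the completion with given compatible components. -/
def mk (z : ∀ n : ℕ, B ⧸ hIdeal B n)
    (hz : ∀ (m n : ℕ) (hmn : m ≤ n),
      Ideal.Quotient.factorₐ ℂ⟦X⟧ (hIdeal_le hmn) (z n) = z m) : HCompletion B := ⟨z, hz⟩

@[simp] theorem eval_mk (z : ∀ n : ℕ, B ⧸ hIdeal B n)
    (hz : ∀ (m n : ℕ) (hmn : m ≤ n),
      Ideal.Quotient.factorₐ ℂ⟦X⟧ (hIdeal_le hmn) (z n) = z m) (n : ℕ) :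
    eval n (mk z hz) = z n := rfl

theorem ext {a b : HCompletion B} (hab : ∀ n, eval n a = eval n b) : a = b :=
  Subtype.ext (funext hab)

theorem factor_eval {m n : ℕ} (hmn : m ≤ n) (a : HCompletion B) :
    Ideal.Quotient.factorₐ ℂ⟦X⟧ (hIdeal_le hmn) (eval n a) = eval m a :=
  a.2 m n hmn

/-- The canonical map from `B` to its completion. -/
def of (B : Type*) [Ring B] [Algebra ℂ⟦X⟧ B] : B →ₐ[ℂ⟦X⟧] HCompletion B :=
  (AlgHom.pi (R := ℂ⟦X⟧)
    (fun n => Ideal.Quotient.mkₐ ℂ⟦X⟧ (hIdeal B n))).codRestrict (hLimit B)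
      (fun _ _ _ _ => rfl)

@[simp] theorem eval_of (n : ℕ) (b : B) :
    eval n (of B b) = Ideal.Quotient.mkₐ ℂ⟦X⟧ (hIdeal B n) b := rfl

theorem exists_rep (n : ℕ) (a : HCompletion B) :
    ∃ b : B, Ideal.Quotient.mkₐ ℂ⟦X⟧ (hIdeal B n) b = eval n a :=
  Ideal.Quotient.mkₐ_surjective ℂ⟦X⟧ _ _

/-- An element of `B` that agrees with `a` modulo `hⁿ`. -/
def rep (n : ℕ) (a : HCompletion B) : B := (exists_rep n a).choose

theorem mk_rep (n : ℕ) (a : HCompletion B) :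
    Ideal.Quotient.mkₐ ℂ⟦X⟧ (hIdeal B n) (rep n a) = eval n a :=
  (exists_rep n a).choose_spec

theorem X_pow_smul_quotient (n : ℕ) (z : B ⧸ hIdeal B n) : (X : ℂ⟦X⟧) ^ n • z = 0 := by
  obtain ⟨b, rfl⟩ := Ideal.Quotient.mkₐ_surjective ℂ⟦X⟧ _ z
  rw [← map_smul]
  exact Ideal.Quotient.eq_zero_iff_mem.2 ⟨b, rfl⟩

theorem eval_X_pow_smul {m n : ℕ} (hmn : m ≤ n) (a : HCompletion B) :
    eval m ((X : ℂ⟦X⟧) ^ n • a) = 0 := by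
  rw [← Nat.sub_add_cancel hmn, pow_add, mul_smul, map_smul, map_smul, X_pow_smul_quotient,
    smul_zero]

theorem eval_eq_zero_of_le {m n : ℕ} (hmn : m ≤ n) {a : HCompletion B} (ha : eval n a = 0) :
    eval m a = 0 := by
  rw [← factor_eval hmn, ha, map_zero]

/-- The sum of the convergent series `∑ fₘ`, where `fₘ` is zero modulo `hᵐ`. -/
def sum (f : ℕ → HCompletion B) (hf : ∀ m, eval m (f m) = 0) : HCompletion B :=
  mk (fun n => ∑ m ∈ Finset.range n, eval n (f m)) (by
    intro m n hmn
    rw [map_sum]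
    simp only [factor_eval hmn]
    refine (Finset.sum_subset (Finset.range_mono hmn) fun i _ hi => ?_).symm
    exact eval_eq_zero_of_le (not_lt.1 fun h => hi (Finset.mem_range.2 h)) (hf i))

@[simp] theorem eval_sum (f : ℕ → HCompletion B) (hf : ∀ m, eval m (f m) = 0) (n : ℕ) :
    eval n (sum f hf) = ∑ m ∈ Finset.range n, eval n (f m) := rfl

theorem eval_coe_smul {c : ℂ⟦X⟧} {n : ℕ} (hc : (X : ℂ⟦X⟧) ^ n ∣ c) (a : HCompletion B) :
    eval n (c • a) = 0 := by
  obtain ⟨d, rfl⟩ := hc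
  rw [mul_smul]
  exact eval_X_pow_smul le_rfl _

theorem eval_linear_eq (μ : A →ₗ[ℂ⟦X⟧] HCompletion B) (n : ℕ) {a b : A}
    (hab : Ideal.Quotient.mkₐ ℂ⟦X⟧ (hIdeal A n) a = Ideal.Quotient.mkₐ ℂ⟦X⟧ (hIdeal A n) b) :
    eval n (μ a) = eval n (μ b) := by
  obtain ⟨c, hc⟩ := Ideal.Quotient.eq.1 hab
  rw [← sub_eq_zero, ← map_sub, ← map_sub, hc, map_smul]
  exact eval_X_pow_smul le_rfl _

theorem eval_linear_rep (μ : A →ₗ[ℂ⟦X⟧] HCompletion B) (z : HCompletion A) {m n : ℕ}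
    (hmn : m ≤ n) :
    eval m (μ (rep n z)) = eval m (μ (rep m z)) := by
  apply eval_linear_eq
  rw [mk_rep m z, ← factor_eval hmn z, ← mk_rep n z]
  rfl

/-- The extension of a `ℂ⟦h⟧`-linear map from `A` to a complete algebra by continuity to the
completion of `A`: modulo `hⁿ`, its value at `z` is the value at any element of `A` that agrees
with `z` modulo `hⁿ`. -/
def extend (μ : A →ₗ[ℂ⟦X⟧] HCompletion B) : HCompletion A →ₗ[ℂ⟦X⟧] HCompletion B where
  toFun z := mk (fun n => eval n (μ (rep n z))) (by
    intro m n hmn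
    rw [factor_eval hmn, eval_linear_rep μ z hmn])
  map_add' a b := by
    apply ext
    intro n
    simp only [map_add, eval_mk]
    rw [← map_add, ← map_add]
    apply eval_linear_eq
    rw [map_add, mk_rep n (a + b), mk_rep n a,
      mk_rep n b, map_add]
  map_smul' r a := by
    apply ext
    intro n
    simp only [map_smul, eval_mk, RingHom.id_apply]
    rw [← map_smul, ← map_smul]
    apply eval_linear_eq
    rw [map_smul, mk_rep n (r • a), mk_rep n a, map_smul]

theorem eval_extend (μ : A →ₗ[ℂ⟦X⟧] HCompletion B) (n : ℕ) (z : HCompletion A) (a : A)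
    (ha : Ideal.Quotient.mkₐ ℂ⟦X⟧ (hIdeal A n) a = eval n z) :
    eval n (extend μ z) = eval n (μ a) := by
  refine eval_linear_eq μ n ?_
  rw [mk_rep n z, ha]

@[simp] theorem extend_of (μ : A →ₗ[ℂ⟦X⟧] HCompletion B) (a : A) : extend μ (of A a) = μ a :=
  ext fun n => eval_extend μ n _ a rfl

/-- The kernel of the projection to `B / hⁿ B` consists of the multiples of `hⁿ`. -/
theorem exists_eq_X_pow_smul {n : ℕ} {z : HCompletion B} (hz : eval n z = 0) :
    ∃ w : HCompletion B, z = (X : ℂ⟦X⟧) ^ n • w := by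
  have hd : rep n z ∈ hIdeal B n := by
    rw [← Ideal.Quotient.eq_zero_iff_mem]
    exact (mk_rep n z).trans hz
  have hc : ∀ i, rep (n + (i + 1)) z - rep (n + i) z ∈ hIdeal B (n + i) := by
    intro i
    refine Ideal.Quotient.eq.1 ?_
    refine Eq.trans ?_ (mk_rep (n + i) z).symm
    rw [← factor_eval (by omega : n + i ≤ n + (i + 1)) z, ← mk_rep (n + (i + 1)) z]
    rfl
  obtain ⟨d, hd⟩ := hd
  choose c hc using hc
  refine ⟨of B d + sum (fun i => (X : ℂ⟦X⟧) ^ i • of B (c i))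
    (fun i => eval_X_pow_smul le_rfl _), ext fun m => ?_⟩
  have key : ∀ m, rep (n + m) z =
      (X : ℂ⟦X⟧) ^ n • d + ∑ i ∈ Finset.range m, (X : ℂ⟦X⟧) ^ (n + i) • c i := by
    intro m
    induction m with
    | zero => simpa using hd
    | succ m ih => rw [Finset.sum_range_succ, ← add_assoc (_ • d), ← ih, ← hc m, add_sub_cancel]
  rw [map_smul, map_add, eval_sum, eval_of]
  simp only [map_smul, eval_of]
  rw [← factor_eval (by omega : m ≤ n + m) z, ← mk_rep (n + m) z, key m, map_add, map_sum]
  simp only [map_smul, map_add, map_sum, smul_add, Finset.smul_sum, smul_smul, ← pow_add]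
  rfl

/-- A `ℂ⟦h⟧`-linear map is continuous. -/
theorem eval_map_eq_zero (μ : HCompletion A →ₗ[ℂ⟦X⟧] HCompletion B) {n : ℕ} {z : HCompletion A}
    (hz : eval n z = 0) : eval n (μ z) = 0 := by
  obtain ⟨w, rfl⟩ := exists_eq_X_pow_smul hz
  rw [map_smul]
  exact eval_X_pow_smul le_rfl _

theorem linear_sum (μ : HCompletion A →ₗ[ℂ⟦X⟧] HCompletion B) (f : ℕ → HCompletion A)
    (hf : ∀ m, eval m (f m) = 0) :
    μ (sum f hf) = sum (fun m => μ (f m)) (fun m => eval_map_eq_zero μ (hf m)) := by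
  apply ext
  intro n
  rw [eval_sum, ← map_sum, ← map_sum, ← sub_eq_zero, ← map_sub, ← map_sub]
  apply eval_map_eq_zero
  rw [map_sub, eval_sum, map_sum, sub_self]

/-- The extension by continuity of an algebra anti-homomorphism. -/
def extendAnti (φ : A →ₐ[ℂ⟦X⟧] (HCompletion B)ᵐᵒᵖ) :
    HCompletion A →ₐ[ℂ⟦X⟧] (HCompletion B)ᵐᵒᵖ :=
  AlgHom.ofLinearMap
    ((MulOpposite.opLinearEquiv ℂ⟦X⟧).toLinearMap ∘ₗ
      extend ((MulOpposite.opLinearEquiv ℂ⟦X⟧).symm.toLinearMap ∘ₗ φ.toLinearMap))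
    (by
      rw [← map_one (of A), LinearMap.comp_apply, extend_of]
      simp)
    (by
      intro a b
      apply MulOpposite.unop_injective
      apply ext
      intro n
      obtain ⟨a', ha⟩ := exists_rep n a
      obtain ⟨b', hb⟩ := exists_rep n b
      simp only [LinearMap.comp_apply, LinearEquiv.coe_coe, MulOpposite.coe_opLinearEquiv,
        MulOpposite.unop_mul, MulOpposite.unop_op, map_mul]
      rw [eval_extend _ n a a' ha, eval_extend _ n b b' hb,
        eval_extend _ n (a * b) (a' * b') (by rw [map_mul, map_mul, ha, hb])]
      simp)

theorem unop_extendAnti (φ : A →ₐ[ℂ⟦X⟧] (HCompletion B)ᵐᵒᵖ) (z : HCompletion A) :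
    (extendAnti φ z).unop =
      extend ((MulOpposite.opLinearEquiv ℂ⟦X⟧).symm.toLinearMap ∘ₗ φ.toLinearMap) z := rfl

@[simp] theorem extendAnti_of (φ : A →ₐ[ℂ⟦X⟧] (HCompletion B)ᵐᵒᵖ) (a : A) :
    extendAnti φ (of A a) = φ a := by
  apply MulOpposite.unop_injective
  rw [unop_extendAnti, extend_of]
  rfl

/-- The element `f(h a) = ∑ fₘ hᵐ aᵐ`, for a formal power series `f = ∑ fₘ tᵐ` over `ℂ`. -/
def hsubst (f : ℂ⟦X⟧) (a : HCompletion B) : HCompletion B :=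
  sum (fun m => monomial m (coeff m f) • a ^ m) (fun m => eval_coe_smul
    (X_pow_dvd_iff.2 fun i hi => by rw [coeff_monomial, if_neg hi.ne]) _)

theorem linear_hsubst (μ : HCompletion A →ₗ[ℂ⟦X⟧] HCompletion B) (f : ℂ⟦X⟧) (a : HCompletion A)
    (b : HCompletion B) (hab : ∀ m, μ (a ^ m) = b ^ m) : μ (hsubst f a) = hsubst f b := by
  rw [hsubst, linear_sum]
  apply ext
  intro n
  simp only [eval_sum, map_smul, hab, hsubst]

theorem commute_hsubst (f : ℂ⟦X⟧) (a : HCompletion B) : Commute a (hsubst f a) := by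
  apply ext
  intro n
  rw [map_mul, map_mul, hsubst, eval_sum, Finset.mul_sum, Finset.sum_mul]
  refine Finset.sum_congr rfl fun i _ => ?_
  rw [← map_mul, ← map_mul, mul_smul_comm, smul_mul_assoc, pow_mul_comm']

theorem hsubst_neg (f : ℂ⟦X⟧) (a : HCompletion B) :
    hsubst f (-a) = hsubst (rescale (-1) f) a := by
  apply ext
  intro n
  rw [hsubst, hsubst, eval_sum, eval_sum]
  refine Finset.sum_congr rfl fun i _ => ?_
  congr 1
  have h1 : (-a) ^ i = ((-1 : ℂ⟦X⟧) ^ i) • a ^ i := by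
    rw [← smul_pow, neg_one_smul]
  rw [h1, smul_smul]
  congr 1
  rw [coeff_rescale, mul_comm]
  rcases Nat.even_or_odd i with hi | hi
  · simp [hi.neg_one_pow]
  · simp [hi.neg_one_pow]

theorem eval_hsubst (f : ℂ⟦X⟧) (a : HCompletion B) (n : ℕ) :
    eval n (hsubst f a) = Polynomial.aeval ((X : ℂ⟦X⟧) • eval n a)
      ((trunc n f).map (C : ℂ →+* ℂ⟦X⟧)) := by
  rw [Polynomial.aeval_def, Polynomial.eval₂_map, eval₂_trunc_eq_sum_range, hsubst, eval_sum]
  refine Finset.sum_congr rfl fun i _ => ?_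
  rw [map_smul, map_pow, smul_pow, RingHom.comp_apply, ← Algebra.smul_def, smul_smul]
  congr 1
  ext j
  rw [coeff_monomial, coeff_C_mul, coeff_X_pow]
  split_ifs <;> simp

theorem hsubst_mul (f g : ℂ⟦X⟧) (a : HCompletion B) :
    hsubst (f * g) a = hsubst f a * hsubst g a := by
  apply ext
  intro n
  rw [map_mul, eval_hsubst, eval_hsubst, eval_hsubst, ← map_mul, ← Polynomial.map_mul,
    ← trunc_trunc_mul_trunc, ← sub_eq_zero, ← map_sub, ← Polynomial.map_sub]
  set p := trunc n f * trunc n g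
  obtain ⟨r, hr⟩ : Polynomial.X ^ n ∣ trunc n (p : ℂ⟦X⟧) - p := by
    rw [Polynomial.X_pow_dvd_iff]
    intro d hd
    rw [Polynomial.coeff_sub, coeff_trunc, if_pos hd, Polynomial.coeff_coe, sub_self]
  have hp : ((trunc n f : ℂ⟦X⟧) * (trunc n g : ℂ⟦X⟧)) = (p : ℂ⟦X⟧) := by
    simp [p]
  rw [hp, hr, Polynomial.map_mul, Polynomial.map_pow, Polynomial.map_X, map_mul, map_pow,
    Polynomial.aeval_X, smul_pow, X_pow_smul_quotient, zero_mul]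

theorem hsubst_one (a : HCompletion B) : hsubst 1 a = 1 := by
  apply ext
  intro n
  rcases n with _ | n
  · rw [← sub_eq_zero, ← map_sub, ← one_smul ℂ⟦X⟧ (hsubst 1 a - 1), ← pow_zero (X : ℂ⟦X⟧)]
    exact eval_X_pow_smul le_rfl _
  · rw [eval_hsubst, trunc_one, Polynomial.map_one, map_one, map_one]

theorem hsubst_sub (f g : ℂ⟦X⟧) (a : HCompletion B) :
    hsubst (f - g) a = hsubst f a - hsubst g a := by
  apply ext
  intro n
  rw [map_sub, eval_hsubst, eval_hsubst, eval_hsubst, trunc_sub, Polynomial.map_sub, map_sub]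

theorem hsubst_X (a : HCompletion B) : hsubst X a = (X : ℂ⟦X⟧) • a := by
  apply ext
  intro n
  rw [eval_hsubst]
  rcases n with _ | _ | n
  · rw [← one_smul ℂ⟦X⟧ (Polynomial.aeval _ _), ← pow_zero (X : ℂ⟦X⟧), X_pow_smul_quotient,
      ← one_smul ℂ⟦X⟧ (X • a), ← pow_zero (X : ℂ⟦X⟧), eval_X_pow_smul le_rfl]
  · have : trunc (0 + 1) (X : ℂ⟦X⟧) = 0 := by
      ext i
      rw [coeff_trunc]
      split_ifs with hi
      · obtain rfl : i = 0 := by omega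
        simp
      · simp
    rw [this, Polynomial.map_zero, map_zero, ← pow_one (X : ℂ⟦X⟧), eval_X_pow_smul le_rfl]
  · rw [trunc_X, Polynomial.map_X, Polynomial.aeval_X, map_smul]

/-- The exponential `e^{c h a}`, for `c ∈ ℂ`. -/
def hexp (c : ℂ) (a : HCompletion B) : HCompletion B := hsubst (rescale c (exp ℂ)) a

theorem hexp_mul (c d : ℂ) (a : HCompletion B) : hexp c a * hexp d a = hexp (c + d) a := by
  rw [hexp, hexp, hexp, ← hsubst_mul, exp_mul_exp_eq_exp_add]

theorem hexp_zero (a : HCompletion B) : hexp 0 a = 1 := by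
  rw [hexp, rescale_zero_apply, constantCoeff_exp, map_one, hsubst_one]

end HCompletion

end Completion

/-! Quantum integers in `ℂ⟦h⟧`. -/

section Scalars

theorem rescale_exp_mul_neg (c : ℂ) : rescale c (exp ℂ) * rescale (-c) (exp ℂ) = 1 := by
  rw [exp_mul_exp_eq_exp_add, add_neg_cancel, rescale_zero_apply, constantCoeff_exp, map_one]

theorem constantCoeff_rescale_exp (c : ℂ) : constantCoeff (rescale c (exp ℂ)) = 1 := by
  rw [← coeff_zero_eq_constantCoeff_apply, coeff_rescale, pow_zero, one_mul,
    coeff_zero_eq_constantCoeff_apply, constantCoeff_exp]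

/-- The unit `q = e^{h/2}` of `ℂ⟦h⟧`. -/
def q : ℂ⟦X⟧ˣ where
  val := rescale (1 / 2) (exp ℂ)
  inv := rescale (-(1 / 2)) (exp ℂ)
  val_inv := rescale_exp_mul_neg _
  inv_val := by rw [mul_comm, rescale_exp_mul_neg]

/-- The element `q - q⁻¹` of `ℂ⟦h⟧`. -/
def qDiff : ℂ⟦X⟧ := (q : ℂ⟦X⟧) - (q⁻¹ : ℂ⟦X⟧ˣ)

/-- The power series `(q - q⁻¹) / h`. -/
def qDiffDivX : ℂ⟦X⟧ := PowerSeries.mk fun n => coeff (n + 1) qDiff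

theorem X_mul_qDiffDivX : X * qDiffDivX = qDiff := by
  ext n
  rcases n with _ | n
  · rw [coeff_zero_X_mul, coeff_zero_eq_constantCoeff_apply, qDiff, map_sub]
    exact (sub_eq_zero.2 ((constantCoeff_rescale_exp _).trans
      (constantCoeff_rescale_exp _).symm)).symm
  · rw [coeff_succ_X_mul, qDiffDivX, coeff_mk]

theorem constantCoeff_qDiffDivX : constantCoeff qDiffDivX = 1 := by
  rw [← coeff_zero_eq_constantCoeff_apply, qDiffDivX, coeff_mk]
  simp [qDiff, q, coeff_rescale, coeff_exp]
  norm_num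

/-- The quantum integer `[n] = (qⁿ - q⁻ⁿ) / (q - q⁻¹)`, a finite geometric sum. -/
def qInt (n : ℕ) : ℂ⟦X⟧ :=
  ∑ i ∈ Finset.range n, (q : ℂ⟦X⟧) ^ i * ((q⁻¹ : ℂ⟦X⟧ˣ) : ℂ⟦X⟧) ^ (n - 1 - i)

theorem qInt_mul (n : ℕ) :
    qInt n * qDiff = (q : ℂ⟦X⟧) ^ n - ((q⁻¹ : ℂ⟦X⟧ˣ) : ℂ⟦X⟧) ^ n :=
  (Commute.all _ _).geom_sum₂_mul n

/-- The quantum factorial `[n]! = [1] [2] ⋯ [n]`. -/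
def qFactorial (n : ℕ) : ℂ⟦X⟧ := ∏ i ∈ Finset.range n, qInt (i + 1)

theorem constantCoeff_qInt (n : ℕ) : constantCoeff (qInt n) = n := by
  simp [qInt, q, constantCoeff_rescale_exp]

/-- The constant term of `[n]!` is `n!`, so that `[n]!` is invertible in `ℂ⟦h⟧`. -/
theorem qFactorial_mul_inv (n : ℕ) : qFactorial n * (qFactorial n)⁻¹ = 1 := by
  refine PowerSeries.mul_inv_cancel _ ?_
  rw [qFactorial, map_prod, Finset.prod_ne_zero_iff]
  intro i _
  rw [constantCoeff_qInt]
  exact Nat.cast_ne_zero.2 i.succ_ne_zero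

/-- The coefficients `((q - q⁻¹)ⁿ / [n]!) q^{n(n-3)/2}`; the exponent is always an integer. -/
def rCoeff (n : ℕ) : ℂ⟦X⟧ :=
  qDiff ^ n * (qFactorial n)⁻¹ * ((q ^ ((n : ℤ) * ((n : ℤ) - 3) / 2) : ℂ⟦X⟧ˣ) : ℂ⟦X⟧)

theorem X_pow_dvd_rCoeff (n : ℕ) : (X : ℂ⟦X⟧) ^ n ∣ rCoeff n := by
  rw [rCoeff, mul_assoc]
  exact (pow_dvd_pow_of_dvd (Dvd.intro _ X_mul_qDiffDivX) n).mul_right _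

end Scalars

/-- The element `[a] = (e^{h a/2} - e^{-h a/2}) / (q - q⁻¹)` of a complete algebra. As
`q - q⁻¹ = h g(h)` with `g` invertible, this is `g(h)⁻¹ • (a * g(h a))`. -/
def qBracket {B : Type*} [Ring B] [Algebra ℂ⟦X⟧ B] (a : HCompletion B) : HCompletion B :=
  qDiffDivX⁻¹ • (a * HCompletion.hsubst qDiffDivX a)

theorem qDiff_smul_qBracket {B : Type*} [Ring B] [Algebra ℂ⟦X⟧ B] (a : HCompletion B) :
    qDiff • qBracket a = HCompletion.hexp (1 / 2) a - HCompletion.hexp (-(1 / 2)) a := by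
  have hinv : qDiffDivX * qDiffDivX⁻¹ = 1 :=
    PowerSeries.mul_inv_cancel _ (by rw [constantCoeff_qDiffDivX]; exact one_ne_zero)
  rw [qBracket, smul_smul]
  nth_rewrite 1 [← X_mul_qDiffDivX]
  rw [mul_assoc, hinv, mul_one, ← smul_mul_assoc, ← HCompletion.hsubst_X,
    ← HCompletion.hsubst_mul, X_mul_qDiffDivX, HCompletion.hexp, HCompletion.hexp,
    ← HCompletion.hsubst_sub]
  rfl

theorem rescale_qDiffDivX : rescale (-1) qDiffDivX = qDiffDivX := by
  have h1 : rescale (-1) qDiff = -qDiff := by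
    have h2 : ∀ c : ℂ, rescale (-1) (rescale c (exp ℂ)) = rescale (-c) (exp ℂ) := by
      intro c
      rw [rescale_rescale, mul_neg_one]
    change rescale (-1) (rescale (1 / 2) (exp ℂ) - rescale (-(1 / 2)) (exp ℂ)) =
      -(rescale (1 / 2) (exp ℂ) - rescale (-(1 / 2)) (exp ℂ))
    rw [map_sub, h2, h2, neg_neg, neg_sub]
  rw [← X_mul_qDiffDivX, map_mul, rescale_neg_one_X, neg_mul, neg_inj] at h1
  exact mul_left_cancel₀ X_ne_zero h1

theorem qBracket_neg {B : Type*} [Ring B] [Algebra ℂ⟦X⟧ B] (a : HCompletion B) :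
    qBracket (-a) = -qBracket a := by
  rw [qBracket, HCompletion.hsubst_neg, rescale_qDiffDivX, neg_mul, smul_neg, qBracket]

/-! The quantized universal enveloping algebra of `sl₂`. -/

/-- The three generators. -/
inductive Gen
  | H
  | x
  | y

/-- The `h`-adically complete free algebra on the generators. -/
abbrev FreeCompletion : Type := HCompletion (FreeAlgebra ℂ⟦X⟧ Gen)

/-- A generator, in the complete free algebra. -/
def freeGen (g : Gen) : FreeCompletion :=
  HCompletion.of (FreeAlgebra ℂ⟦X⟧ Gen) (FreeAlgebra.ι ℂ⟦X⟧ g)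

/-- The defining relations `H x - x H = 2 x`, `H y - y H = - 2 y` and
`x y - y x = (e^{h H/2} - e^{-h H/2}) / (e^{h/2} - e^{-h/2})`. -/
inductive Rel : FreeCompletion → FreeCompletion → Prop
  | Hx : Rel (freeGen .H * freeGen .x - freeGen .x * freeGen .H) (2 * freeGen .x)
  | Hy : Rel (freeGen .H * freeGen .y - freeGen .y * freeGen .H) (-(2 * freeGen .y))
  | xy : Rel (freeGen .x * freeGen .y - freeGen .y * freeGen .x) (qBracket (freeGen .H))

/-- The quotient of the complete free algebra by the ideal of the relations. -/
abbrev Presented : Type := RingQuot Rel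

/-- The quantized universal enveloping algebra `U_h(sl₂)`: the `h`-adically complete
`ℂ⟦h⟧`-algebra topologically generated by `H`, `x`, `y` subject to the defining relations, that
is, the complete free algebra modulo the closure of the ideal of the relations. -/
abbrev U : Type := HCompletion Presented

/-- The map from the complete free algebra to `U_h(sl₂)`. -/
def proj : FreeCompletion →ₐ[ℂ⟦X⟧] U :=
  (HCompletion.of Presented).comp (RingQuot.mkAlgHom ℂ⟦X⟧ Rel)

/-- A generator, in `U_h(sl₂)`. -/
def gen (g : Gen) : U := proj (freeGen g)

/-- The element `k = e^{h H/4}`. -/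
def k : U := HCompletion.hexp (1 / 4) (gen .H)

/-- The element `e^{-h H/4}`, the inverse of `k`. -/
def kInv : U := HCompletion.hexp (-(1 / 4)) (gen .H)

theorem proj_qBracket (a : FreeCompletion) : proj (qBracket a) = qBracket (proj a) := by
  rw [qBracket, map_smul, map_mul, qBracket]
  congr 2
  exact HCompletion.linear_hsubst proj.toLinearMap _ _ _ (fun m => map_pow proj a m)

theorem proj_rel {a b : FreeCompletion} (hab : Rel a b) : proj a = proj b :=
  congrArg (HCompletion.of Presented) (RingQuot.mkAlgHom_rel ℂ⟦X⟧ hab)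

theorem H_mul_x : gen .H * gen .x - gen .x * gen .H = 2 * gen .x := by
  have h1 := proj_rel Rel.Hx
  simp only [map_sub, map_mul, map_ofNat] at h1
  exact h1

theorem H_mul_y : gen .H * gen .y - gen .y * gen .H = -(2 * gen .y) := by
  have h1 := proj_rel Rel.Hy
  simp only [map_sub, map_mul, map_neg, map_ofNat] at h1
  exact h1

theorem x_mul_y : gen .x * gen .y - gen .y * gen .x = qBracket (gen .H) := by
  have h1 := proj_rel Rel.xy
  simp only [map_sub, map_mul, proj_qBracket] at h1
  exact h1

theorem k_mul_kInv : k * kInv = 1 := by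
  rw [k, kInv, HCompletion.hexp_mul, add_neg_cancel, HCompletion.hexp_zero]

theorem kInv_mul_k : kInv * k = 1 := by
  rw [k, kInv, HCompletion.hexp_mul, neg_add_cancel, HCompletion.hexp_zero]

/-- The values of the antipode on the generators: `H ↦ -H`, `x ↦ - q x`, `y ↦ - q⁻¹ y`. -/
def antipodeGen : Gen → U
  | .H => -gen .H
  | .x => -((q : ℂ⟦X⟧) • gen .x)
  | .y => -(((q⁻¹ : ℂ⟦X⟧ˣ) : ℂ⟦X⟧) • gen .y)

/-- The antipode on the complete free algebra, with values in `U_h(sl₂)`. -/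
def antipodeFree : FreeCompletion →ₐ[ℂ⟦X⟧] Uᵐᵒᵖ :=
  HCompletion.extendAnti
    (FreeAlgebra.lift ℂ⟦X⟧ (fun g : Gen => MulOpposite.op (antipodeGen g)))

theorem antipodeFree_gen (g : Gen) :
    antipodeFree (freeGen g) = MulOpposite.op (antipodeGen g) := by
  rw [antipodeFree, freeGen, HCompletion.extendAnti_of, FreeAlgebra.lift_ι_apply]

theorem antipodeFree_qBracket :
    antipodeFree (qBracket (freeGen .H)) = MulOpposite.op (qBracket (-gen .H)) := by
  have h1 : antipodeFree (HCompletion.hsubst qDiffDivX (freeGen .H)) =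
      MulOpposite.op (HCompletion.hsubst qDiffDivX (-gen .H)) := by
    apply MulOpposite.unop_injective
    refine HCompletion.linear_hsubst
      ((MulOpposite.opLinearEquiv ℂ⟦X⟧).symm.toLinearMap ∘ₗ antipodeFree.toLinearMap) _ _ _
      (fun m => ?_)
    change (antipodeFree (freeGen .H ^ m)).unop = _
    rw [map_pow, antipodeFree_gen]
    rfl
  rw [qBracket, map_smul, map_mul, h1, antipodeFree_gen, ← MulOpposite.op_mul,
    ← MulOpposite.op_smul, qBracket, (HCompletion.commute_hsubst _ _).eq]
  rfl

theorem antipodeFree_rel ⦃a b : FreeCompletion⦄ (hab : Rel a b) :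
    antipodeFree a = antipodeFree b := by
  cases hab with
  | Hx =>
    simp only [map_sub, map_mul, antipodeFree_gen, map_ofNat]
    apply MulOpposite.unop_injective
    simp only [MulOpposite.unop_sub, MulOpposite.unop_mul, MulOpposite.unop_op, antipodeGen,
      neg_mul_neg, smul_mul_assoc, mul_smul_comm, MulOpposite.unop_ofNat]
    rw [← smul_sub, ← neg_sub, H_mul_x, neg_mul, smul_mul_assoc, smul_neg, two_mul, mul_two]
  | Hy =>
    simp only [map_sub, map_mul, map_neg, antipodeFree_gen, map_ofNat]
    apply MulOpposite.unop_injective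
    simp only [MulOpposite.unop_sub, MulOpposite.unop_mul, MulOpposite.unop_op, antipodeGen,
      neg_mul_neg, smul_mul_assoc, mul_smul_comm, MulOpposite.unop_ofNat, MulOpposite.unop_neg]
    rw [← smul_sub, ← neg_sub, H_mul_y, neg_mul, smul_mul_assoc, neg_neg, neg_neg, two_mul,
      mul_two]
  | xy =>
    simp only [map_sub, map_mul, antipodeFree_gen, antipodeFree_qBracket]
    apply MulOpposite.unop_injective
    simp only [MulOpposite.unop_sub, MulOpposite.unop_mul, MulOpposite.unop_op, antipodeGen,
      neg_mul_neg, smul_mul_assoc, mul_smul_comm, smul_smul, Units.mul_inv, Units.inv_mul,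
      one_smul]
    rw [qBracket_neg, ← x_mul_y, neg_sub]

/-- The antipode of `U_h(sl₂)` as an algebra homomorphism to the opposite algebra. -/
def antipodeHom : U →ₐ[ℂ⟦X⟧] Uᵐᵒᵖ :=
  HCompletion.extendAnti (RingQuot.liftAlgHom ℂ⟦X⟧ ⟨antipodeFree, antipodeFree_rel⟩)

/-- The antipode `S` of `U_h(sl₂)`: the `ℂ⟦h⟧`-linear algebra anti-homomorphism with
`S(H) = -H`, `S(x) = - q x` and `S(y) = - q⁻¹ y`. -/
def S : U →ₗ[ℂ⟦X⟧] U :=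
  (MulOpposite.opLinearEquiv ℂ⟦X⟧).symm.toLinearMap ∘ₗ antipodeHom.toLinearMap

theorem S_mul (a b : U) : S (a * b) = S b * S a := by
  change (antipodeHom (a * b)).unop = (antipodeHom b).unop * (antipodeHom a).unop
  rw [map_mul, MulOpposite.unop_mul]

theorem S_one : S 1 = 1 := by
  change (antipodeHom 1).unop = 1
  rw [map_one, MulOpposite.unop_one]

theorem S_gen (g : Gen) : S (gen g) = antipodeGen g := by
  change (antipodeHom (HCompletion.of Presented (RingQuot.mkAlgHom ℂ⟦X⟧ Rel _))).unop = _
  rw [antipodeHom, HCompletion.extendAnti_of]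
  refine (congrArg MulOpposite.unop (RingQuot.liftAlgHom_mkAlgHom_apply ℂ⟦X⟧ antipodeFree
    antipodeFree_rel (freeGen g))).trans ?_
  rw [antipodeFree_gen, MulOpposite.unop_op]

/-! The `R`-matrix and the Drinfeld element. -/

/-- The completed tensor product of two copies of `U_h(sl₂)`. -/
abbrev UU : Type := HCompletion (U ⊗[ℂ⟦X⟧] U)

/-- The element `a ⊗ b` of the completed tensor product. -/
def tens (a b : U) : UU := HCompletion.of (U ⊗[ℂ⟦X⟧] U) (a ⊗ₜ[ℂ⟦X⟧] b)

/-- The `R`-matrix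
`R = e^{(h/4) H ⊗ H} ∑ₙ ((q - q⁻¹)ⁿ / [n]!) q^{n(n-3)/2} (k x)ⁿ ⊗ (k⁻¹ y)ⁿ`. -/
def R : UU :=
  HCompletion.hexp (1 / 4) (tens (gen .H) (gen .H)) *
    HCompletion.sum (fun n => rCoeff n • tens ((k * gen .x) ^ n) ((kInv * gen .y) ^ n))
      (fun n => HCompletion.eval_coe_smul (X_pow_dvd_rCoeff n) _)

/-- The linear map `a ⊗ b ↦ S(b) a` on the algebraic tensor product. -/
def drinfeldMap : U ⊗[ℂ⟦X⟧] U →ₗ[ℂ⟦X⟧] U :=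
  TensorProduct.lift ((LinearMap.mul ℂ⟦X⟧ U ∘ₗ S).flip)

theorem drinfeldMap_tmul (a b : U) : drinfeldMap (a ⊗ₜ[ℂ⟦X⟧] b) = S b * a := rfl

/-- The Drinfeld element `u = ∑ᵢ S(βᵢ) αᵢ` of `R = ∑ᵢ αᵢ ⊗ βᵢ`: the image of `R` under the
continuous extension of `a ⊗ b ↦ S(b) a` to the completed tensor product. -/
def u : U := HCompletion.extend drinfeldMap R

end Uhsl2

end

/-! Write C for `casimir`, that is yx + [(H+1)/2]². Every term of u has weight zero, so u is a
function of H and C alone. Applying b ↦ S(b) to the second tensor factors turns u into the series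
with coefficients `uCoeff n` and terms (yk)ⁿ e^{-hH²/4} (kx)ⁿ. A second application of S gives S(u)
with the same coefficients and the terms (xk⁻¹)ⁿ e^{-hH²/4} (k⁻¹y)ⁿ. Since yx = C - [(H+1)/2]², xy =
C - [(H-1)/2]² and f(H,C) x = x f(H+2,C), both series are images under `polyToU` of series in a
complete polynomial algebra in two variables (`u_eq`, `S_u_eq`). Only a homomorphism into U is
needed, not its injectivity, so no basis of U enters.

In the polynomial algebra the identity is `polySU_eq`. By `poly_ext` it may be checked at the points
H = 2m, C = c with m an integer. There u becomes a scalar series u(a) with a = 2m, and S(u) becomes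
u(-a), so the claim reads u(-2m) = e^{-2mh} u(2m).

Behind this lies the centrality of e^{-hH/2} u. Its scalar form is u(a) = e^{-h} u(a+2). The partial
sums satisfy this up to an explicit remainder (`uValue_succ_eq`) that contains `uCoeff N`, hence is
divisible by h^N. So e^{-mh} u(2m) does not depend on m, and comparing m with -m gives the claim. -/

noncomputable section

namespace Uhsl2

/-! The identity for scalars. -/

section Scalars

/-- The series `e^{c h}`. -/
def expS (c : ℂ) : ℂ⟦X⟧ := rescale c (exp ℂ)

theorem expS_mul (a b : ℂ) : expS a * expS b = expS (a + b) := exp_mul_exp_eq_exp_add a b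

theorem expS_zero : expS 0 = 1 := by
  rw [expS, rescale_zero_apply, constantCoeff_exp, map_one]

theorem expS_pow (a : ℂ) (n : ℕ) : expS a ^ n = expS (n * a) := by
  induction n with
  | zero => simp [expS_zero]
  | succ n ih =>
    rw [pow_succ, ih, expS_mul]
    congr 1
    push_cast
    ring

theorem coe_q : (q : ℂ⟦X⟧) = expS (1 / 2) := rfl

theorem coe_q_inv : ((q⁻¹ : ℂ⟦X⟧ˣ) : ℂ⟦X⟧) = expS (-(1 / 2)) := rfl

theorem coe_q_zpow (n : ℤ) : ((q ^ n : ℂ⟦X⟧ˣ) : ℂ⟦X⟧) = expS (n / 2) := by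
  cases n with
  | ofNat n =>
    rw [Int.ofNat_eq_natCast, zpow_natCast, Units.val_pow_eq_pow_val, coe_q, expS_pow]
    congr 1
    push_cast
    ring
  | negSucc n =>
    rw [zpow_negSucc, ← inv_pow, Units.val_pow_eq_pow_val, coe_q_inv, expS_pow]
    congr 1
    push_cast
    ring

theorem qDiff_ne_zero : qDiff ≠ 0 := by
  rw [← X_mul_qDiffDivX]
  refine mul_ne_zero X_ne_zero fun h => ?_
  have := constantCoeff_qDiffDivX
  simp [h] at this

/-- The quantum number `[a] ∈ ℂ⟦h⟧` for `a ∈ ℂ`. -/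
def qNum (a : ℂ) : ℂ⟦X⟧ := qDiffDivX⁻¹ * (C a * rescale a qDiffDivX)

theorem qDiff_mul_qNum (a : ℂ) : qDiff * qNum a = expS (a / 2) - expS (-(a / 2)) := by
  have hinv : qDiffDivX * qDiffDivX⁻¹ = 1 :=
    PowerSeries.mul_inv_cancel _ (by rw [constantCoeff_qDiffDivX]; exact one_ne_zero)
  have h1 : rescale a qDiff = expS (a / 2) - expS (-(a / 2)) := by
    rw [qDiff, map_sub, coe_q, coe_q_inv, expS, expS, rescale_rescale, rescale_rescale, expS, expS]
    congr 3 <;> ring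
  rw [← h1, ← X_mul_qDiffDivX, map_mul, rescale_X, qNum]
  linear_combination (C a * X * rescale a qDiffDivX) * hinv

theorem qInt_mul_qDiff (n : ℕ) : qInt n * qDiff = expS (n / 2) - expS (-(n / 2)) := by
  rw [qInt_mul, coe_q, coe_q_inv, expS_pow, expS_pow]
  congr 2 <;> ring

theorem qNum_sq_sub_sq (a : ℂ) (n : ℕ) :
    qNum (a + n) ^ 2 - qNum a ^ 2 = qInt n * qNum (2 * a + n) := by
  apply mul_left_cancel₀ (pow_ne_zero 2 qDiff_ne_zero)
  have h1 : qDiff ^ 2 * (qInt n * qNum (2 * a + n)) =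
      (qInt n * qDiff) * (qDiff * qNum (2 * a + n)) := by ring
  rw [h1, mul_sub, ← mul_pow, ← mul_pow, qDiff_mul_qNum, qDiff_mul_qNum, qDiff_mul_qNum,
    qInt_mul_qDiff]
  simp only [sq, mul_sub, sub_mul, expS_mul]
  ring_nf

theorem qNum_neg (a : ℂ) : qNum (-a) = -qNum a := by
  apply mul_left_cancel₀ qDiff_ne_zero
  rw [qDiff_mul_qNum, mul_neg, qDiff_mul_qNum, neg_sub]
  congr 2 <;> ring

theorem qInt_one : qInt 1 = 1 := by
  simp [qInt]

/-- The eigenvalue of `y x` on a vector of weight `a` on which the Casimir element is `c`. -/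
def weightCoeff (c a : ℂ) : ℂ⟦X⟧ := C c - qNum ((a + 1) / 2) ^ 2

/-- A difference of squares of quantum numbers factors, by `qNum_sq_sub_sq`. The factor [n] is what
later cancels against the quantum factorial. -/
theorem weightCoeff_eq (c a : ℂ) (n : ℕ) :
    weightCoeff c a = weightCoeff c (a + 2 * n) + qInt n * qNum (a + 1 + n) := by
  have := qNum_sq_sub_sq ((a + 1) / 2) n
  rw [mul_div_cancel₀ (a + 1) two_ne_zero] at this
  rw [← this, weightCoeff, weightCoeff, show (a + 2 * n + 1) / 2 = (a + 1) / 2 + n by ring]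
  ring

/-- The right side is the eigenvalue of xy in weight a, so this is the symmetry that exchanges x
with y and a with -a. -/
theorem weightCoeff_neg (c a : ℂ) : weightCoeff c (-a) = weightCoeff c (a - 2) := by
  rw [weightCoeff, weightCoeff, ← neg_sq, ← qNum_neg]
  congr 3
  ring

/-- The eigenvalue of `(y k)ⁿ e^{-h H²/4} (k x)ⁿ` on a vector of weight `a` on which the Casimir
element is `c`. -/
def termValue (c : ℂ) : ℕ → ℂ → ℂ⟦X⟧
  | 0, a => expS (-(a ^ 2 / 4))
  | n + 1, a => weightCoeff c a * (expS ((a + 2) / 2) * termValue c n (a + 2))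

/-- The definition peels off the outermost pair y, x; this peels off the innermost one. The exponent
is (b+2)/2 - ((b+2)² - b²)/4 = -b/2 with b = a + 2n. -/
theorem termValue_succ (c : ℂ) (n : ℕ) (a : ℂ) :
    termValue c (n + 1) a =
      weightCoeff c (a + 2 * n) * (expS (-((a + 2 * n) / 2)) * termValue c n a) := by
  induction n generalizing a with
  | zero =>
    simp only [termValue, expS_mul, Nat.cast_zero, mul_zero, add_zero]
    ring_nf
  | succ n ih =>
    rw [termValue, ih]
    conv_rhs => rw [termValue]
    push_cast
    rw [show a + 2 + 2 * (n : ℂ) = a + 2 * (n + 1) by ring]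
    ring

/-- The products for a and a+2 share all but one factor: the first factor at a is traded for the
last one at a+2, and `weightCoeff_eq` measures the difference. -/
theorem termValue_succ_eq (c : ℂ) (n : ℕ) (a : ℂ) :
    termValue c (n + 1) a = expS (a + n + 2) * termValue c (n + 1) (a + 2) +
      qInt (n + 1) * qNum (a + n + 2) * expS ((a + 2) / 2) * termValue c n (a + 2) := by
  rw [termValue_succ c n (a + 2), termValue, weightCoeff_eq c a (n + 1)]
  have h1 : expS (a + n + 2) * expS (-((a + 2 + 2 * n) / 2)) = expS ((a + 2) / 2) := by
    rw [expS_mul]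
    ring_nf
  rw [← h1]
  push_cast
  ring_nf

/-! ### The recurrence in the weight for the partial sums of u -/

/-- The coefficients of the Drinfeld element. -/
def uCoeff (n : ℕ) : ℂ⟦X⟧ := rCoeff n * (-expS (-(1 / 2))) ^ n

theorem X_pow_dvd_uCoeff (n : ℕ) : (X : ℂ⟦X⟧) ^ n ∣ uCoeff n :=
  (X_pow_dvd_rCoeff n).mul_right _

theorem uCoeff_succ (n : ℕ) :
    uCoeff (n + 1) * qInt (n + 1) = -(uCoeff n * qDiff * expS ((n - 2) / 2)) := by
  have h0 := qFactorial_mul_inv n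
  have h1 := qFactorial_mul_inv (n + 1)
  have h2 : qFactorial (n + 1) = qFactorial n * qInt (n + 1) := Finset.prod_range_succ _ _
  have h3 : (qFactorial (n + 1))⁻¹ * qInt (n + 1) = (qFactorial n)⁻¹ := by
    rw [h2] at h1 ⊢
    linear_combination (qFactorial n)⁻¹ * h1 -
      ((qFactorial n * qInt (n + 1))⁻¹ * qInt (n + 1)) * h0
  -- The numerators differ by 2(n - 1), which passes through the integer division without any parity
  -- argument.
  have h4 : ((n + 1 : ℕ) : ℤ) * (((n + 1 : ℕ) : ℤ) - 3) / 2 =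
      (n : ℤ) * ((n : ℤ) - 3) / 2 + (n - 1) := by
    rw [← Int.add_mul_ediv_right _ _ two_ne_zero]
    congr 1
    push_cast
    ring
  rw [uCoeff, uCoeff, rCoeff, rCoeff, h4, zpow_add, Units.val_mul, coe_q_zpow ((n : ℤ) - 1),
    show ((n : ℂ) - 2) / 2 = (((n : ℤ) - 1 : ℤ) : ℂ) / 2 + -(1 / 2) by push_cast; ring, ← expS_mul,
    ← h3, pow_succ, pow_succ]
  ring

/-- The partial sums of the eigenvalue of the Drinfeld element. -/
def uValue (c : ℂ) (N : ℕ) (a : ℂ) : ℂ⟦X⟧ := ∑ n ∈ Finset.range N, uCoeff n * termValue c n a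

/-- A telescoping identity, exact at every N; the last summand is the remainder that vanishes
h-adically. -/
theorem uValue_succ_eq (c : ℂ) (N : ℕ) (a : ℂ) :
    uValue c (N + 1) a = expS (-1) * uValue c N (a + 2) +
      uCoeff N * expS (a + N + 1) * termValue c N (a + 2) := by
  induction N with
  | zero =>
    simp only [uValue, zero_add, Finset.sum_range_one, Finset.sum_range_zero, mul_zero, termValue,
      mul_assoc, expS_mul]
    congr 2
    push_cast
    ring
  | succ N ih =>
    -- With `uCoeff_succ`, the bracket term of `termValue_succ_eq` cancels the old remainder except
    -- for its e^{-h} part, which is the next term of the sum at a+2.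
    have h1 : expS (a + N + 1) =
        expS (-1) + expS ((N - 2) / 2) * expS ((a + 2) / 2) * (qDiff * qNum (a + N + 2)) := by
      rw [qDiff_mul_qNum, mul_sub, expS_mul, expS_mul, expS_mul]
      ring_nf
    have h2 := uCoeff_succ N
    rw [uValue, Finset.sum_range_succ, ← uValue, ih, uValue, uValue, Finset.sum_range_succ,
      termValue_succ_eq, h1]
    push_cast
    rw [show a + (N + 1) + 1 = a + (N : ℂ) + 2 by ring]
    linear_combination
      (qNum (a + N + 2) * expS ((a + 2) / 2) * termValue c N (a + 2)) * h2

theorem X_pow_dvd_uValue_sub (c : ℂ) (N : ℕ) (a : ℂ) :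
    (X : ℂ⟦X⟧) ^ N ∣ expS (-((a + 2) / 2)) * uValue c N (a + 2) -
      expS (-(a / 2)) * uValue c N a := by
  have h1 := uValue_succ_eq c N a
  rw [uValue, Finset.sum_range_succ, ← uValue] at h1
  have h2 : expS (-((a + 2) / 2)) = expS (-(a / 2)) * expS (-1) := by
    rw [expS_mul]
    ring_nf
  obtain ⟨d, hd⟩ := X_pow_dvd_uCoeff N
  refine ⟨expS (-(a / 2)) * d * (termValue c N a - expS (a + N + 1) * termValue c N (a + 2)), ?_⟩
  rw [h2]
  linear_combination -expS (-(a / 2)) * h1 + expS (-(a / 2)) *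
    (termValue c N a - expS (a + N + 1) * termValue c N (a + 2)) * hd

/-- The recurrence moves the weight by 2, so induction in both directions from 0 reaches exactly the
even integers. -/
theorem X_pow_dvd_uValue_sub_zero (c : ℂ) (N : ℕ) (m : ℤ) :
    (X : ℂ⟦X⟧) ^ N ∣ expS (-m) * uValue c N (2 * m) - uValue c N 0 := by
  induction m using Int.induction_on with
  | zero => simp [expS_zero]
  | succ m ih =>
    have h1 := (X_pow_dvd_uValue_sub c N (2 * m)).add ih
    push_cast at h1 ih ⊢
    rw [show -((2 * (m : ℂ) + 2) / 2) = -(m + 1) by ring, show -(2 * (m : ℂ) / 2) = -m by ring,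
      show 2 * (m : ℂ) + 2 = 2 * (m + 1) by ring] at h1
    simpa using h1
  | pred m ih =>
    have h1 := ih.sub (X_pow_dvd_uValue_sub c N (2 * (-m - 1)))
    push_cast at h1 ih ⊢
    rw [show 2 * (-(m : ℂ) - 1) + 2 = 2 * (-m) by ring,
      show -(2 * -(m : ℂ) / 2) = - -m by ring,
      show -(2 * (-(m : ℂ) - 1) / 2) = -(-m - 1) by ring] at h1
    convert h1 using 1
    ring

theorem X_pow_dvd_uValue_neg_sub (c : ℂ) (N : ℕ) (m : ℤ) :
    (X : ℂ⟦X⟧) ^ N ∣ uValue c N (-(2 * m)) - expS (-(2 * m)) * uValue c N (2 * m) := by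
  have h1 := X_pow_dvd_uValue_sub_zero c N m
  have h2 := X_pow_dvd_uValue_sub_zero c N (-m)
  have h3 := ((h2.sub h1).mul_left (expS (-m)))
  push_cast at h3
  have h4 : expS (-(m : ℂ)) * expS (- -m) = 1 := by rw [expS_mul, add_neg_cancel, expS_zero]
  have h5 : expS (-(m : ℂ)) * expS (-m) = expS (-(2 * m)) := by rw [expS_mul]; ring_nf
  convert h3 using 1
  rw [← h5, mul_neg]
  linear_combination -uValue c N (-(2 * m)) * h4

end Scalars

variable {A B D : Type*} [Ring A] [Algebra ℂ⟦X⟧ A] [Ring B] [Algebra ℂ⟦X⟧ B]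
  [Ring D] [Algebra ℂ⟦X⟧ D]

/-! Linear and multiplicative maps between complete algebras. -/

namespace HCompletion

/-- Linear maps commute with convergent series, so agreement on powers suffices. Multiplicativity is
not required, as the extension of `drinfeldMap` demands. -/
theorem linear_hsubst_eq (μ : HCompletion A →ₗ[ℂ⟦X⟧] HCompletion D)
    (ν : HCompletion B →ₗ[ℂ⟦X⟧] HCompletion D) (f : ℂ⟦X⟧) (a : HCompletion A)
    (b : HCompletion B) (hab : ∀ m, μ (a ^ m) = ν (b ^ m)) : μ (hsubst f a) = ν (hsubst f b) := by
  rw [hsubst, hsubst, linear_sum, linear_sum]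
  apply ext
  intro n
  simp only [eval_sum, map_smul, hab]

theorem map_hexp (φ : HCompletion A →ₐ[ℂ⟦X⟧] HCompletion B) (c : ℂ) (a : HCompletion A) :
    φ (hexp c a) = hexp c (φ a) :=
  linear_hsubst φ.toLinearMap _ _ _ (fun m => map_pow φ a m)

theorem map_qBracket (φ : HCompletion A →ₐ[ℂ⟦X⟧] HCompletion B) (a : HCompletion A) :
    φ (qBracket a) = qBracket (φ a) := by
  rw [qBracket, map_smul, map_mul, qBracket]
  congr 2
  exact linear_hsubst φ.toLinearMap _ _ _ (fun m => map_pow φ a m)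

theorem hexp_neg (c : ℂ) (a : HCompletion B) : hexp c (-a) = hexp (-c) a := by
  rw [hexp, hsubst_neg, rescale_rescale, mul_neg_one, hexp]

theorem sum_congr {f g : ℕ → HCompletion B} (hf : ∀ m, eval m (f m) = 0)
    (hfg : ∀ m, f m = g m) : sum f hf = sum g (fun m => hfg m ▸ hf m) := by
  congr 1
  exact funext hfg

/-- The image of A is dense, and linear maps are automatically h-adically continuous. -/
theorem linear_ext {μ ν : HCompletion A →ₗ[ℂ⟦X⟧] HCompletion B}
    (h : ∀ a, μ (of A a) = ν (of A a)) : μ = ν := by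
  refine LinearMap.ext fun z => ext fun n => ?_
  have h1 : eval n (z - of A (rep n z)) = 0 := by
    rw [map_sub, eval_of, mk_rep, sub_self]
  have h2 := eval_map_eq_zero (μ - ν) h1
  rw [map_sub, LinearMap.sub_apply (μ) ν (of A _), h, sub_self, sub_zero, LinearMap.sub_apply,
    map_sub, sub_eq_zero] at h2
  exact h2

/-- The extension by continuity of an algebra homomorphism. -/
def extendAlg (φ : A →ₐ[ℂ⟦X⟧] HCompletion B) : HCompletion A →ₐ[ℂ⟦X⟧] HCompletion B :=
  AlgHom.ofLinearMap (extend φ.toLinearMap)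
    (by
      rw [← map_one (of A), extend_of]
      simp)
    (by
      intro a b
      apply ext
      intro n
      obtain ⟨a', ha⟩ := exists_rep n a
      obtain ⟨b', hb⟩ := exists_rep n b
      rw [map_mul (eval n), eval_extend _ n a a' ha, eval_extend _ n b b' hb,
        eval_extend _ n (a * b) (a' * b') (by rw [map_mul, map_mul, ha, hb])]
      simp)

theorem extendAlg_of (φ : A →ₐ[ℂ⟦X⟧] HCompletion B) (a : A) : extendAlg φ (of A a) = φ a :=
  extend_of φ.toLinearMap a

/-- A complex number, as an element of a complete algebra. -/
def ofComplex (B : Type*) [Ring B] [Algebra ℂ⟦X⟧ B] (c : ℂ) : HCompletion B :=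
  algebraMap ℂ⟦X⟧ _ (C c)

theorem map_ofComplex (φ : HCompletion A →ₐ[ℂ⟦X⟧] HCompletion B) (c : ℂ) :
    φ (ofComplex A c) = ofComplex B c := φ.commutes _

theorem ofComplex_commute (c : ℂ) (a : HCompletion B) : Commute (ofComplex B c) a :=
  Algebra.commutes _ _

theorem algebraMap_hsubst (f : ℂ⟦X⟧) (c : ℂ) :
    hsubst f (ofComplex B c) = algebraMap ℂ⟦X⟧ _ (rescale c f) := by
  apply ext
  intro n
  have h1 : (X : ℂ⟦X⟧) ^ n ∣ rescale c f -
      ∑ m ∈ Finset.range n, monomial m (coeff m f) * C c ^ m := by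
    rw [X_pow_dvd_iff]
    intro i hi
    rw [map_sub, map_sum, coeff_rescale, Finset.sum_eq_single i]
    · rw [← map_pow, coeff_mul_C, coeff_monomial_same, mul_comm, sub_self]
    · intro b _ hb
      rw [← map_pow, coeff_mul_C, coeff_monomial, if_neg hb.symm, zero_mul]
    · intro h
      exact absurd (Finset.mem_range.2 hi) h
  have h2 := eval_coe_smul h1 (1 : HCompletion B)
  rw [← Algebra.algebraMap_eq_smul_one, map_sub, map_sub, sub_eq_zero] at h2
  rw [h2, hsubst, eval_sum, map_sum, map_sum]
  refine Finset.sum_congr rfl fun m _ => ?_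
  rw [map_mul, map_pow, ← Algebra.smul_def, ofComplex]

theorem hexp_ofComplex (c d : ℂ) :
    hexp c (ofComplex B d) = algebraMap ℂ⟦X⟧ _ (expS (d * c)) := by
  rw [hexp, algebraMap_hsubst, rescale_rescale, mul_comm d, expS]

theorem qBracket_ofComplex (c : ℂ) :
    qBracket (ofComplex B c) = algebraMap ℂ⟦X⟧ _ (qNum c) := by
  rw [qBracket, algebraMap_hsubst, ofComplex, ← map_mul, Algebra.smul_def, ← map_mul, qNum]

theorem X_pow_dvd_of_eval_algebraMap {n : ℕ} {f : ℂ⟦X⟧}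
    (hf : eval n (algebraMap ℂ⟦X⟧ (HCompletion ℂ⟦X⟧) f) = 0) : (X : ℂ⟦X⟧) ^ n ∣ f := by
  have h1 : algebraMap ℂ⟦X⟧ (HCompletion ℂ⟦X⟧) f = of ℂ⟦X⟧ f := (of ℂ⟦X⟧).commutes f |>.symm
  rw [h1, eval_of] at hf
  obtain ⟨c, hc⟩ := Ideal.Quotient.eq_zero_iff_mem.1 hf
  exact ⟨c, hc⟩

end HCompletion

open HCompletion

/-! The complete polynomial algebra in two variables, which will stand for `H` and for the
Casimir element. -/

/-- Polynomials in two variables. -/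
abbrev Poly : Type := Polynomial (Polynomial ℂ⟦X⟧)

/-- The first variable. -/
def polyH : HCompletion Poly := of Poly (Polynomial.C Polynomial.X)

/-- The second variable. -/
def polyC : HCompletion Poly := of Poly Polynomial.X

/-- The homomorphism to a complete algebra that sends the variables to two commuting elements. -/
def polyHom (a c : HCompletion B) (hac : Commute a c) : HCompletion Poly →ₐ[ℂ⟦X⟧] HCompletion B :=
  extendAlg (Polynomial.eval₂AlgHom (Polynomial.aeval a) c (fun p => by
    induction p using Polynomial.induction_on' with
    | add p r hp hr =>
      rw [map_add]
      exact hp.add_left hr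
    | monomial n r =>
      rw [Polynomial.aeval_monomial]
      exact (Algebra.commute_algebraMap_left r c).mul_left (hac.pow_left n)))

theorem polyHom_polyH (a c : HCompletion B) (hac : Commute a c) : polyHom a c hac polyH = a := by
  rw [polyHom, polyH, extendAlg_of]
  exact (Polynomial.eval₂_C _ _).trans (Polynomial.aeval_X a)

theorem polyHom_polyC (a c : HCompletion B) (hac : Commute a c) : polyHom a c hac polyC = c := by
  rw [polyHom, polyC, extendAlg_of]
  exact Polynomial.eval₂_X _ _

/-- The z that satisfy the conclusion form a closed subalgebra, so the two variables suffice. With t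
= x this yields the shift of H; with t = 1, uniqueness of homomorphisms. -/
theorem poly_intertwine {φ ψ : HCompletion Poly →ₐ[ℂ⟦X⟧] HCompletion B} {t : HCompletion B}
    (hH : φ polyH * t = t * ψ polyH) (hC : φ polyC * t = t * ψ polyC) (z : HCompletion Poly) :
    φ z * t = t * ψ z := by
  suffices h : (LinearMap.mulRight ℂ⟦X⟧ t) ∘ₗ φ.toLinearMap =
      (LinearMap.mulLeft ℂ⟦X⟧ t) ∘ₗ ψ.toLinearMap from LinearMap.congr_fun h z
  have hadd : ∀ a b, φ a * t = t * ψ a → φ b * t = t * ψ b → φ (a + b) * t = t * ψ (a + b) := by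
    intro a b ha hb
    rw [map_add, map_add, add_mul, mul_add, ha, hb]
  have hmul : ∀ a b, φ a * t = t * ψ a → φ b * t = t * ψ b → φ (a * b) * t = t * ψ (a * b) := by
    intro a b ha hb
    rw [map_mul, map_mul, mul_assoc, hb, ← mul_assoc, ha, mul_assoc]
  have hpow : ∀ a, φ a * t = t * ψ a → ∀ n : ℕ, φ (a ^ n) * t = t * ψ (a ^ n) := by
    intro a ha n
    induction n with
    | zero => simp
    | succ n ih =>
      rw [pow_succ]
      exact hmul _ _ ih ha
  refine linear_ext fun p => ?_
  change φ (of Poly p) * t = t * ψ (of Poly p)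
  induction p using Polynomial.induction_on' with
  | add p r hp hr =>
    rw [map_add]
    exact hadd _ _ hp hr
  | monomial n p =>
    rw [← Polynomial.C_mul_X_pow_eq_monomial, map_mul, map_pow]
    refine hmul _ _ ?_ (hpow _ hC n)
    induction p using Polynomial.induction_on' with
    | add p r hp hr =>
      rw [map_add, map_add]
      exact hadd _ _ hp hr
    | monomial n r =>
      rw [← Polynomial.C_mul_X_pow_eq_monomial, map_mul, map_pow, map_mul, map_pow]
      refine hmul _ _ ?_ (hpow _ hH n)
      have h1 : of Poly (Polynomial.C (Polynomial.C r)) = algebraMap ℂ⟦X⟧ _ r :=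
        (of Poly).commutes r
      rw [h1, AlgHom.commutes, AlgHom.commutes]
      exact Algebra.commutes _ _

theorem poly_algHom_ext {φ ψ : HCompletion Poly →ₐ[ℂ⟦X⟧] HCompletion B}
    (hH : φ polyH = ψ polyH) (hC : φ polyC = ψ polyC) : φ = ψ := by
  refine AlgHom.ext fun z => ?_
  simpa using poly_intertwine (t := 1) (by simpa using hH) (by simpa using hC) z

/-! ### Evaluation at points, and the density of the even weights -/

/-- The evaluation at a pair of complex numbers. -/
def polyEval (c a : ℂ) : HCompletion Poly →ₐ[ℂ⟦X⟧] HCompletion ℂ⟦X⟧ :=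
  polyHom (ofComplex _ a) (ofComplex _ c) (ofComplex_commute _ _)

theorem polyEval_of (c a : ℂ) (p : Poly) :
    polyEval c a (of Poly p) = algebraMap ℂ⟦X⟧ _ (p.evalEval (C a) (C c)) := by
  have h1 : polyEval c a = extendAlg ((Algebra.ofId ℂ⟦X⟧ (HCompletion ℂ⟦X⟧)).comp
      ((Polynomial.aeval (C a : ℂ⟦X⟧)).comp
        ((Polynomial.aeval (Polynomial.C (C c) : Polynomial ℂ⟦X⟧)).restrictScalars ℂ⟦X⟧))) := by
    apply poly_algHom_ext
    · rw [polyEval, polyHom_polyH, polyH, extendAlg_of]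
      simp [Algebra.ofId_apply, ofComplex]
    · rw [polyEval, polyHom_polyC, polyC, extendAlg_of]
      simp [Algebra.ofId_apply, ofComplex]
  rw [h1, extendAlg_of]
  simp [Algebra.ofId_apply, Polynomial.evalEval]

theorem poly_eq_zero_of_evalEval (p : Polynomial (Polynomial ℂ))
    (hp : ∀ (m : ℤ) (c : ℂ), p.evalEval (2 * (m : ℂ)) c = 0) : p = 0 := by
  have h1 : ∀ m : ℤ, p.map (Polynomial.evalRingHom (2 * (m : ℂ))) = 0 := by
    intro m
    refine Polynomial.funext fun c => ?_
    rw [Polynomial.eval_zero, ← hp m c, Polynomial.map_evalRingHom_eval]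
  ext1 i
  rw [Polynomial.coeff_zero]
  refine Polynomial.eq_zero_of_infinite_isRoot _ ?_
  refine (Set.infinite_range_of_injective (f := fun m : ℤ => 2 * (m : ℂ)) ?_).mono ?_
  · intro m n hmn
    simpa using hmn
  · rintro _ ⟨m, rfl⟩
    have h2 := congrArg (fun r => r.coeff i) (h1 m)
    simpa [Polynomial.coeff_map] using h2

/-- Reduced modulo h, p vanishes on an infinite set times ℂ and so is zero. Then p is divisible by
h, and the quotient satisfies the hypothesis for n - 1. -/
theorem X_pow_dvd_poly (n : ℕ) (p : Poly)
    (hp : ∀ (m : ℤ) (c : ℂ), (X : ℂ⟦X⟧) ^ n ∣ p.evalEval (C (2 * (m : ℂ))) (C c)) :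
    ∃ r : Poly, p = (X : ℂ⟦X⟧) ^ n • r := by
  induction n generalizing p with
  | zero => exact ⟨p, by simp⟩
  | succ n ih =>
    have h1 : p.map (Polynomial.mapRingHom (constantCoeff (R := ℂ))) = 0 := by
      apply poly_eq_zero_of_evalEval
      intro m c
      have h2 := X_dvd_iff.1 ((dvd_pow_self X n.succ_ne_zero).trans (hp m c))
      have h3 := Polynomial.map_mapRingHom_evalEval (constantCoeff (R := ℂ)) p
        (C (2 * (m : ℂ))) (C c)
      rw [h2] at h3
      simpa using h3
    have h2 : Polynomial.C (Polynomial.C (X : ℂ⟦X⟧)) ∣ p := by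
      rw [Polynomial.C_dvd_iff_dvd_coeff]
      intro i
      rw [Polynomial.C_dvd_iff_dvd_coeff]
      intro j
      rw [X_dvd_iff]
      have h4 := congrArg (fun r => (r.coeff i).coeff j) h1
      simpa [Polynomial.coeff_map] using h4
    obtain ⟨r, rfl⟩ := h2
    obtain ⟨s, rfl⟩ := ih r (by
      intro m c
      have h3 := hp m c
      rw [Polynomial.evalEval_mul, pow_succ'] at h3
      simp only [Polynomial.evalEval_C, Polynomial.eval_C] at h3
      exact (mul_dvd_mul_iff_left X_ne_zero).1 h3)
    refine ⟨s, ?_⟩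
    rw [pow_succ', mul_smul, Algebra.smul_def (X : ℂ⟦X⟧)]
    rfl

/-- An element of the complete polynomial algebra is determined by its values. -/
theorem poly_ext {z w : HCompletion Poly}
    (h : ∀ (m : ℤ) (c : ℂ), polyEval c (2 * m) z = polyEval c (2 * m) w) : z = w := by
  rw [← sub_eq_zero]
  apply HCompletion.ext
  intro n
  rw [map_zero, ← mk_rep]
  refine Ideal.Quotient.eq_zero_iff_mem.2 (X_pow_dvd_poly n _ fun m c => ?_)
  apply X_pow_dvd_of_eval_algebraMap
  rw [← polyEval_of]
  have h1 : eval n (of Poly (rep n (z - w)) - (z - w)) = 0 := by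
    rw [map_sub, eval_of, mk_rep, sub_self]
  have h2 := eval_map_eq_zero (polyEval c (2 * m)).toLinearMap h1
  simpa [h m c] using h2

/-! Squares of quantum brackets. -/

/-- The element `[(a + s) / 2]²`. -/
def bracketSq (a : HCompletion B) (s : ℂ) : HCompletion B :=
  qBracket (ofComplex B (1 / 2) * (a + ofComplex B s)) ^ 2

theorem map_bracketSq (φ : HCompletion A →ₐ[ℂ⟦X⟧] HCompletion B) (a : HCompletion A) (s : ℂ) :
    φ (bracketSq a s) = bracketSq (φ a) s := by
  rw [bracketSq, map_pow, map_qBracket, map_mul, map_add, map_ofComplex, map_ofComplex, bracketSq]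

theorem ofComplex_add (a b : ℂ) : ofComplex B a + ofComplex B b = ofComplex B (a + b) := by
  simp [ofComplex]

theorem bracketSq_add (a : HCompletion B) (s t : ℂ) :
    bracketSq (a + ofComplex B s) t = bracketSq a (s + t) := by
  rw [bracketSq, add_assoc, ofComplex_add, bracketSq]

theorem bracketSq_ofComplex (a s : ℂ) :
    bracketSq (ofComplex B a) s = algebraMap ℂ⟦X⟧ _ (qNum ((a + s) / 2) ^ 2) := by
  have h1 : ofComplex B (1 / 2) * (ofComplex B a + ofComplex B s) = ofComplex B ((a + s) / 2) := by
    rw [ofComplex_add, ofComplex, ofComplex, ofComplex, ← map_mul, ← map_mul]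
    congr 2
    ring
  rw [bracketSq, h1, qBracket_ofComplex, map_pow]

theorem polyEval_polyH (c a : ℂ) : polyEval c a polyH = ofComplex _ a := polyHom_polyH _ _ _

theorem polyEval_polyC (c a : ℂ) : polyEval c a polyC = ofComplex _ c := polyHom_polyC _ _ _

theorem bracketSq_sub (a : HCompletion B) :
    bracketSq a 1 - bracketSq a (-1) = qBracket a := by
  have h1 : bracketSq polyH 1 - bracketSq polyH (-1) = qBracket polyH := by
    refine poly_ext fun m c => ?_
    rw [map_sub, map_bracketSq, map_bracketSq, map_qBracket, polyEval_polyH, bracketSq_ofComplex,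
      bracketSq_ofComplex, qBracket_ofComplex, ← map_sub]
    have h2 := qNum_sq_sub_sq ((2 * m + -1) / 2) 1
    rw [qInt_one, one_mul, Nat.cast_one, show (2 * (m : ℂ) + -1) / 2 + 1 = (2 * m + 1) / 2 by ring,
      show 2 * ((2 * (m : ℂ) + -1) / 2) + 1 = 2 * m by ring] at h2
    rw [h2]
  -- The identity holds for a free variable and is specialised to a; the second variable does not
  -- occur and may go to 1.
  have h3 := congrArg (polyHom a 1 (Commute.one_right a)) h1
  rwa [map_sub, map_bracketSq, map_bracketSq, map_qBracket, polyHom_polyH] at h3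

/-! The Casimir element. -/

theorem ofComplex_two (B : Type*) [Ring B] [Algebra ℂ⟦X⟧ B] :
    ofComplex B 2 = 2 := by
  rw [ofComplex, map_ofNat, map_ofNat]

theorem H_x (s : ℂ) :
    (gen .H + ofComplex _ s) * gen .x = gen .x * (gen .H + ofComplex _ (s + 2)) := by
  have h1 := H_mul_x
  rw [← ofComplex_add, ofComplex_two, add_mul, mul_add, mul_add, (ofComplex_commute s (gen .x)).eq,
    sub_eq_iff_eq_add.1 h1, two_mul, mul_two]
  abel

theorem H_y (s : ℂ) :
    (gen .H + ofComplex _ s) * gen .y = gen .y * (gen .H + ofComplex _ (s + -2)) := by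
  have h1 := H_mul_y
  have h2 : ofComplex Presented (-2) = -2 := by
    rw [← ofComplex_two, ofComplex, ofComplex, ← map_neg, ← map_neg]
  rw [← ofComplex_add, h2, add_mul, mul_add, mul_add, (ofComplex_commute s (gen .y)).eq,
    sub_eq_iff_eq_add.1 h1, two_mul, mul_neg, mul_two]
  abel

theorem ofComplex_zero (B : Type*) [Ring B] [Algebra ℂ⟦X⟧ B] :
    ofComplex B 0 = 0 := by
  simp [ofComplex]

theorem bracketSq_mul_of_mul {a b t : U} (h : a * t = t * b) (s : ℂ) :
    bracketSq a s * t = t * bracketSq b s := by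
  have h1 := poly_intertwine (φ := polyHom a 1 (Commute.one_right a))
    (ψ := polyHom b 1 (Commute.one_right b)) (t := t)
    (by rw [polyHom_polyH, polyHom_polyH, h])
    (by rw [polyHom_polyC, polyHom_polyC, one_mul, mul_one]) (bracketSq polyH s)
  rwa [map_bracketSq, map_bracketSq, polyHom_polyH, polyHom_polyH] at h1

/-- The Casimir element `y x + [(H + 1) / 2]²`. -/
def casimir : U := gen .y * gen .x + bracketSq (gen .H) 1

theorem casimir_eq : casimir = gen .x * gen .y + bracketSq (gen .H) (-1) := by
  rw [casimir, sub_eq_iff_eq_add.1 x_mul_y, sub_eq_iff_eq_add.1 (bracketSq_sub (gen .H))]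
  abel

/-- Moving x to the left turns [(H-1)/2]² into [(H+1)/2]², and so the xy form of the Casimir element
into its yx form. -/
theorem casimir_mul_x : casimir * gen .x = gen .x * casimir := by
  have h1 : bracketSq (gen .H) (-1) * gen .x = gen .x * bracketSq (gen .H) 1 := by
    have h2 := H_x 0
    rw [ofComplex_zero, add_zero, zero_add] at h2
    rw [bracketSq_mul_of_mul h2, bracketSq_add]
    norm_num
  rw [casimir_eq, add_mul, h1, mul_assoc, ← mul_add]
  rw [← casimir_eq, casimir]

theorem commute_H_casimir : Commute (gen .H) casimir := by
  have h1 : Commute (gen .H) (gen .y * gen .x) := by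
    have h2 := H_y 0
    have h3 := H_x (-2)
    rw [ofComplex_zero, add_zero, zero_add] at h2
    rw [neg_add_cancel, ofComplex_zero, add_zero] at h3
    change _ = _
    rw [← mul_assoc, h2, mul_assoc, h3, mul_assoc]
  have h4 := bracketSq_mul_of_mul (rfl : gen .H * gen .H = _) 1
  exact h1.add_right h4.symm

/-! The homomorphism from the complete polynomial algebra to `U_h(sl₂)`. -/

/-- The homomorphism that sends the variables to `H` and to the Casimir element. -/
def polyToU : HCompletion Poly →ₐ[ℂ⟦X⟧] U := polyHom (gen .H) casimir commute_H_casimir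

theorem commute_polyH_polyC : Commute polyH polyC := by
  change of Poly _ * of Poly _ = of Poly _ * of Poly _
  rw [← map_mul (of Poly), ← map_mul (of Poly), Polynomial.X_mul]

/-- The translation `H ↦ H + s` of the first variable. -/
def shift (s : ℂ) : HCompletion Poly →ₐ[ℂ⟦X⟧] HCompletion Poly :=
  polyHom (polyH + ofComplex _ s) polyC (commute_polyH_polyC.add_left (ofComplex_commute _ _))

theorem polyEval_shift (c a s : ℂ) (f : HCompletion Poly) :
    polyEval c a (shift s f) = polyEval c (a + s) f := by
  have h1 : (polyEval c a).comp (shift s) = polyEval c (a + s) := by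
    apply poly_algHom_ext
    · rw [AlgHom.comp_apply, shift, polyHom_polyH, map_add, polyEval_polyH, polyEval_polyH,
        map_ofComplex, ofComplex_add]
    · rw [AlgHom.comp_apply, shift, polyHom_polyC, polyEval_polyC, polyEval_polyC]
  exact AlgHom.congr_fun h1 f

theorem polyToU_shift_polyH (s : ℂ) : polyToU (shift s polyH) = gen .H + ofComplex _ s := by
  rw [shift, polyHom_polyH, map_add, map_ofComplex, polyToU, polyHom_polyH]

theorem polyToU_polyH : polyToU polyH = gen .H := polyHom_polyH _ _ _

theorem polyToU_polyC : polyToU polyC = casimir := polyHom_polyC _ _ _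

theorem shift_polyC (s : ℂ) : shift s polyC = polyC := polyHom_polyC _ _ _

theorem polyToU_mul_x (f : HCompletion Poly) :
    polyToU f * gen .x = gen .x * polyToU (shift 2 f) := by
  refine poly_intertwine (φ := polyToU) (ψ := polyToU.comp (shift 2)) ?_ ?_ f
  · have h1 := H_x 0
    rw [ofComplex_zero, add_zero, zero_add] at h1
    rw [AlgHom.comp_apply, polyToU_shift_polyH, polyToU_polyH, h1]
  · rw [AlgHom.comp_apply, shift_polyC, polyToU_polyC, casimir_mul_x]

theorem polyToU_shift_mul_x (f : HCompletion Poly) :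
    polyToU (shift (-2) f) * gen .x = gen .x * polyToU f := by
  rw [← AlgHom.comp_apply polyToU (shift (-2))]
  refine poly_intertwine ?_ ?_ f
  · rw [AlgHom.comp_apply, polyToU_shift_polyH, H_x, neg_add_cancel, ofComplex_zero, add_zero,
      polyToU_polyH]
  · rw [AlgHom.comp_apply, shift_polyC, polyToU_polyC, casimir_mul_x]

/-! ### The terms of u and S(u) as elements of the polynomial algebra -/

/-- The operator on polynomials that corresponds to `f ↦ (y k) f (k x)`. -/
def lowerRaise (f : HCompletion Poly) : HCompletion Poly :=
  (polyC - bracketSq polyH 1) * shift 2 (hexp (1 / 4) polyH * f * hexp (1 / 4) polyH)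

/-- The operator on polynomials that corresponds to `f ↦ (x k⁻¹) f (k⁻¹ y)`. -/
def raiseLower (f : HCompletion Poly) : HCompletion Poly :=
  shift (-2) (hexp (-(1 / 4)) polyH * f * hexp (-(1 / 4)) polyH) * (polyC - bracketSq polyH (-1))

theorem polyToU_k : polyToU (hexp (1 / 4) polyH) = k := by
  rw [map_hexp, polyToU_polyH, k]

theorem polyToU_kInv : polyToU (hexp (-(1 / 4)) polyH) = kInv := by
  rw [map_hexp, polyToU_polyH, kInv]

theorem polyToU_lowerRaise (f : HCompletion Poly) :
    polyToU (lowerRaise f) = (gen .y * k) * polyToU f * (k * gen .x) := by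
  have h1 : polyToU (polyC - bracketSq polyH 1) = gen .y * gen .x := by
    rw [map_sub, map_bracketSq, polyToU_polyH, polyToU_polyC, casimir, add_sub_cancel_right]
  rw [lowerRaise, map_mul, h1, mul_assoc, ← polyToU_mul_x, map_mul, map_mul, polyToU_k]
  simp only [mul_assoc]

theorem polyToU_raiseLower (f : HCompletion Poly) :
    polyToU (raiseLower f) = (gen .x * kInv) * polyToU f * (kInv * gen .y) := by
  have h1 : polyToU (polyC - bracketSq polyH (-1)) = gen .x * gen .y := by
    rw [map_sub, map_bracketSq, polyToU_polyH, polyToU_polyC, casimir_eq, add_sub_cancel_right]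
  rw [raiseLower, map_mul, h1, ← mul_assoc, polyToU_shift_mul_x, map_mul, map_mul, polyToU_kInv]
  simp only [mul_assoc]

theorem polyToU_lowerRaise_iterate (n : ℕ) (f : HCompletion Poly) :
    polyToU (lowerRaise^[n] f) = (gen .y * k) ^ n * polyToU f * (k * gen .x) ^ n := by
  induction n with
  | zero => simp
  | succ n ih =>
    rw [Function.iterate_succ_apply', polyToU_lowerRaise, ih, pow_succ', pow_succ]
    simp only [mul_assoc]

theorem polyToU_raiseLower_iterate (n : ℕ) (f : HCompletion Poly) :
    polyToU (raiseLower^[n] f) = (gen .x * kInv) ^ n * polyToU f * (kInv * gen .y) ^ n := by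
  induction n with
  | zero => simp
  | succ n ih =>
    rw [Function.iterate_succ_apply', polyToU_raiseLower, ih, pow_succ', pow_succ]
    simp only [mul_assoc]

/-- The element `e^{-h H²/4}`. -/
def polyGauss : HCompletion Poly := hexp (1 / 4) (-polyH ^ 2)

theorem polyEval_polyGauss (c a : ℂ) :
    polyEval c a polyGauss = algebraMap ℂ⟦X⟧ _ (expS (-(a ^ 2 / 4))) := by
  have h1 : -ofComplex ℂ⟦X⟧ a ^ 2 = ofComplex ℂ⟦X⟧ (-a ^ 2) := by simp [ofComplex]
  rw [polyGauss, map_hexp, map_neg, map_pow, polyEval_polyH, h1, hexp_ofComplex]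
  congr 2
  ring

theorem polyEval_lowerRaise_iterate (c a : ℂ) (n : ℕ) :
    polyEval c a (lowerRaise^[n] polyGauss) = algebraMap ℂ⟦X⟧ _ (termValue c n a) := by
  induction n generalizing a with
  | zero => exact polyEval_polyGauss c a
  | succ n ih =>
    have h1 : expS ((a + 2) / 2) = expS ((a + 2) * (1 / 4)) * expS ((a + 2) * (1 / 4)) := by
      rw [expS_mul]
      ring_nf
    rw [Function.iterate_succ_apply', lowerRaise, map_mul, polyEval_shift, map_sub, map_mul,
      map_mul, map_hexp, map_bracketSq, ih, polyEval_polyH, polyEval_polyH, polyEval_polyC,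
      hexp_ofComplex, bracketSq_ofComplex, ofComplex, ← map_sub, ← map_mul, ← map_mul, ← map_mul,
      termValue, weightCoeff, h1]
    congr 1
    ring

/-- Exchanging x with y amounts to a ↦ -a: the Gaussian is even, the powers of k are inverted, and
`weightCoeff_neg` matches the eigenvalues of xy and yx. -/
theorem polyEval_raiseLower_iterate (c a : ℂ) (n : ℕ) :
    polyEval c a (raiseLower^[n] polyGauss) = algebraMap ℂ⟦X⟧ _ (termValue c n (-a)) := by
  induction n generalizing a with
  | zero =>
    rw [termValue, neg_sq]
    exact polyEval_polyGauss c a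
  | succ n ih =>
    have h1 : expS ((-a + 2) / 2) = expS ((a + -2) * -(1 / 4)) * expS ((a + -2) * -(1 / 4)) := by
      rw [expS_mul]
      ring_nf
    rw [Function.iterate_succ_apply', raiseLower, map_mul, polyEval_shift, map_sub, map_mul,
      map_mul, map_hexp, map_bracketSq, ih, polyEval_polyH, polyEval_polyH, polyEval_polyC,
      hexp_ofComplex, bracketSq_ofComplex, ofComplex, ← map_sub, ← map_mul, ← map_mul, ← map_mul,
      termValue, weightCoeff_neg, weightCoeff, h1, show -(a + -2) = -a + 2 by ring,
      show a - 2 + 1 = a + -1 by ring]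
    congr 1
    ring

/-- The polynomial form of `u`. -/
def polyU : HCompletion Poly :=
  HCompletion.sum (fun n => uCoeff n • lowerRaise^[n] polyGauss)
    (fun n => eval_coe_smul (X_pow_dvd_uCoeff n) _)

/-- The polynomial form of `S(u)`. -/
def polySU : HCompletion Poly :=
  HCompletion.sum (fun n => uCoeff n • raiseLower^[n] polyGauss)
    (fun n => eval_coe_smul (X_pow_dvd_uCoeff n) _)

theorem eval_polyEval_polyU (c a : ℂ) (N : ℕ) :
    eval N (polyEval c a polyU) = eval N (algebraMap ℂ⟦X⟧ _ (uValue c N a)) := by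
  have h1 := linear_sum (polyEval c a).toLinearMap (fun n => uCoeff n • lowerRaise^[n] polyGauss)
    (fun n => eval_coe_smul (X_pow_dvd_uCoeff n) _)
  refine (congrArg (eval N) h1).trans ?_
  rw [eval_sum, uValue, map_sum, map_sum]
  refine Finset.sum_congr rfl fun n _ => ?_
  rw [AlgHom.toLinearMap_apply, map_smul, polyEval_lowerRaise_iterate, Algebra.smul_def, ← map_mul]

theorem eval_polyEval_polySU (c a : ℂ) (N : ℕ) :
    eval N (polyEval c a polySU) = eval N (algebraMap ℂ⟦X⟧ _ (uValue c N (-a))) := by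
  have h1 := linear_sum (polyEval c a).toLinearMap (fun n => uCoeff n • raiseLower^[n] polyGauss)
    (fun n => eval_coe_smul (X_pow_dvd_uCoeff n) _)
  refine (congrArg (eval N) h1).trans ?_
  rw [eval_sum, uValue, map_sum, map_sum]
  refine Finset.sum_congr rfl fun n _ => ?_
  rw [AlgHom.toLinearMap_apply, map_smul, polyEval_raiseLower_iterate, Algebra.smul_def, ← map_mul]

theorem polySU_eq : polySU = hexp (-(1 / 4)) polyH ^ 4 * polyU := by
  refine poly_ext fun m c => HCompletion.ext fun N => ?_
  -- This is the value of k⁻⁴ at H = 2m.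
  have h1 : expS (2 * m * -(1 / 4)) ^ 4 = expS (-(2 * m)) := by
    rw [expS_pow]
    congr 1
    push_cast
    ring
  obtain ⟨d, hd⟩ := X_pow_dvd_uValue_neg_sub c N m
  rw [map_mul, map_mul, map_pow, map_hexp, polyEval_polyH, hexp_ofComplex, ← map_pow, h1,
    eval_polyEval_polySU, eval_polyEval_polyU, ← map_mul, ← map_mul, ← sub_eq_zero, ← map_sub,
    ← map_sub, hd, Algebra.algebraMap_eq_smul_one]
  exact eval_coe_smul (Dvd.intro _ rfl) _

/-! The Drinfeld element. -/

theorem tens_mul (a b c d : U) : tens a b * tens c d = tens (a * c) (b * d) := by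
  rw [tens, tens, tens, ← map_mul, Algebra.TensorProduct.tmul_mul_tmul]

theorem tens_pow (a b : U) (n : ℕ) : tens a b ^ n = tens (a ^ n) (b ^ n) := by
  rw [tens, tens, ← map_pow, Algebra.TensorProduct.tmul_pow]

theorem S_pow (a : U) (n : ℕ) : S (a ^ n) = S a ^ n := by
  induction n with
  | zero => rw [pow_zero, pow_zero, S_one]
  | succ n ih => rw [pow_succ, S_mul, ih, pow_succ']

/-- S reverses products, so Hᵐa ⊗ Hᵐb goes to S(b)(-H)ᵐHᵐa: the powers of H meet in the middle and
the exponential of H ⊗ H becomes a Gaussian. -/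
theorem extend_drinfeldMap_hexp_mul (a b : U) :
    extend drinfeldMap (hexp (1 / 4) (tens (gen .H) (gen .H)) * tens a b) =
      S b * hexp (1 / 4) (-gen .H ^ 2) * a := by
  refine linear_hsubst_eq (extend drinfeldMap ∘ₗ LinearMap.mulRight ℂ⟦X⟧ (tens a b))
    (LinearMap.mulRight ℂ⟦X⟧ a ∘ₗ LinearMap.mulLeft ℂ⟦X⟧ (S b)) _ _ _ fun m => ?_
  change extend drinfeldMap (tens (gen .H) (gen .H) ^ m * tens a b) =
    S b * (-gen .H ^ 2) ^ m * a
  rw [tens_pow, tens_mul, tens, extend_of, drinfeldMap_tmul, S_mul, S_pow, S_gen, antipodeGen]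
  rw [← mul_assoc, mul_assoc (S b), sq, ← neg_mul, (Commute.refl (gen .H)).neg_left.mul_pow]

theorem u_eq_sum : u = HCompletion.sum
    (fun n => rCoeff n •
      (S ((kInv * gen .y) ^ n) * hexp (1 / 4) (-gen .H ^ 2) * (k * gen .x) ^ n))
    (fun n => eval_coe_smul (X_pow_dvd_rCoeff n) _) := by
  have h1 := linear_sum
    (extend drinfeldMap ∘ₗ LinearMap.mulLeft ℂ⟦X⟧ (hexp (1 / 4) (tens (gen .H) (gen .H))))
    (fun n => rCoeff n • tens ((k * gen .x) ^ n) ((kInv * gen .y) ^ n))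
    (fun n => eval_coe_smul (X_pow_dvd_rCoeff n) _)
  refine Eq.trans h1 (sum_congr _ fun n => ?_)
  rw [map_smul, ← extend_drinfeldMap_hexp_mul]
  rfl

theorem S_hexp (c : ℂ) (a : U) : S (hexp c a) = hexp c (S a) :=
  linear_hsubst S _ _ _ (S_pow a)

theorem S_k : S k = kInv := by
  rw [k, S_hexp, S_gen, antipodeGen, hexp_neg, kInv]

theorem S_kInv : S kInv = k := by
  rw [k, kInv, S_hexp, S_gen, antipodeGen, hexp_neg, neg_neg]

theorem S_kInv_mul_y : S (kInv * gen .y) = (-expS (-(1 / 2))) • (gen .y * k) := by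
  rw [S_mul, S_kInv, S_gen, antipodeGen, coe_q_inv, neg_smul, neg_mul, smul_mul_assoc]

theorem S_y_mul_k : S (gen .y * k) = (-expS (-(1 / 2))) • (kInv * gen .y) := by
  rw [S_mul, S_k, S_gen, antipodeGen, coe_q_inv, neg_smul, mul_neg, mul_smul_comm]

theorem S_k_mul_x : S (k * gen .x) = (-expS (1 / 2)) • (gen .x * kInv) := by
  rw [S_mul, S_k, S_gen, antipodeGen, coe_q, neg_smul, neg_mul, smul_mul_assoc]

theorem polyToU_polyGauss : polyToU polyGauss = hexp (1 / 4) (-gen .H ^ 2) := by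
  rw [polyGauss, map_hexp, map_neg, map_pow, polyToU_polyH]

theorem S_gauss : S (hexp (1 / 4) (-gen .H ^ 2)) = hexp (1 / 4) (-gen .H ^ 2) := by
  rw [S_hexp, map_neg, S_pow, S_gen, antipodeGen, neg_sq]

theorem u_eq : u = polyToU polyU := by
  refine u_eq_sum.trans (Eq.trans ?_ (linear_sum polyToU.toLinearMap _ _).symm)
  refine sum_congr _ fun n => ?_
  rw [AlgHom.toLinearMap_apply, map_smul, polyToU_lowerRaise_iterate, polyToU_polyGauss, S_pow,
    S_kInv_mul_y, smul_pow, smul_mul_assoc, smul_mul_assoc, smul_smul, uCoeff]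

/-- The second application of S contributes (-q)ⁿ from (kx)ⁿ and (-q⁻¹)ⁿ from (yk)ⁿ. These cancel,
so the coefficients stay those of u. -/
theorem S_u_eq : S u = polyToU polySU := by
  rw [u_eq_sum, linear_sum]
  refine Eq.trans ?_ (linear_sum polyToU.toLinearMap _ _).symm
  refine sum_congr _ fun n => ?_
  have h1 : expS (1 / 2) * expS (-(1 / 2)) = 1 := by rw [expS_mul, add_neg_cancel, expS_zero]
  rw [AlgHom.toLinearMap_apply, map_smul, map_smul, polyToU_raiseLower_iterate, polyToU_polyGauss,
    S_mul, S_mul, S_gauss, S_pow, S_pow, S_pow, S_kInv_mul_y, S_k_mul_x, map_smul, S_y_mul_k,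
    smul_pow, smul_pow, smul_pow, smul_mul_assoc, mul_smul_comm, mul_smul_comm, mul_smul_comm,
    mul_smul_comm, smul_smul, smul_smul, smul_smul, uCoeff, mul_assoc (rCoeff n), ← mul_pow, neg_mul_neg,
    h1, one_pow, mul_one, ← mul_assoc]

end Uhsl2

theorem lemmaL : Uhsl2.S Uhsl2.u = Uhsl2.kInv ^ 4 * Uhsl2.u := by
  rw [Uhsl2.S_u_eq, Uhsl2.u_eq, Uhsl2.polySU_eq, map_mul, map_pow, Uhsl2.polyToU_kInv]

end
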